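/- Let $p>q>1$ be coprime integers and $A_p=\{0,1,\dots,p-1\}$. Evaluate a word $a_k\cdots a_1a_0$ over $A_p$ as $\sum_{i=0}^{k}\frac{a_i}{q}\left(\frac pq\right)^i$, and let $N_{p/q}\subset\mathbb{Q}$ be the set of the values of all words over $A_p$ (the empty word has value $0$). Each $x\in N_{p/q}$ has a unique expansion (a word whose value is $x$) that does not start with the digit $0$; it is denoted by $\langle x\rangle$, and $|\langle x\rangle|$ is its length. A $d$-tuple $\mathbf{x}=(x_0,\dots,x_{d-1})\in(N_{p/q})^d$ is represented by the unique word $\langle\mathbf{x}\rangle=(u_0,\dots,u_{d-1})$ over the alphabet $(A_p)^d$ that does not start with the letter $\mathbf{0}=(0,\dots,0)$ and satisfies $u_i\in 0^*\langle x_i\rangle$ for every $i$. A $d$-tape automaton is a finite deterministic automaton over the alphabet $(A_p)^d$, with a possibly partial transition function, that reads words either from left to right or from right to left. It is padded if it accepts a word $\mathbf{u}$ if and only if it accepts $\mathbf{0}\mathbf{u}$. A set $S\subseteq(N_{p/q})^d$ is $\frac pq$-recognisable if some padded $d$-tape automaton accepts exactly the language $\mathbf{0}^*\langle S\rangle$,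 where $\langle S\rangle=\{\langle\mathbf{x}\rangle:\mathbf{x}\in S\}$. Let $V_{p/q}\colon N_{p/q}\to N_{p/q}$ map $0$ to $0$ and each $x>0$ to the largest power $y$ of $\frac pq$ such that $xy^{-1}\in N_{p/q}$, and write $x\preceq y$ if $|\langle x\rangle|\le|\langle y\rangle|$. Theorem. For every integer $d\ge 1$, a set $S\subseteq(N_{p/q})^d$ is $\frac pq$-recognisable if and only if it is definable, by a first-order formula without parameters, in the structure $\langle N_{p/q},+,V_{p/q},\preceq\rangle$. -/

import Mathlib

/-- A rational base `p / q`: two coprime integers with `p > q > 1`. -/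
structure RationalBase where
  p : ℕ
  q : ℕ
  one_lt_q : 1 < q
  q_lt_p : q < p
  coprime : Nat.Coprime p q

namespace RationalBase

instance instNeZeroP (b : RationalBase) : NeZero b.p :=
  ⟨by have h₁ := b.one_lt_q; have h₂ := b.q_lt_p; omega⟩

/-- The canonical alphabet `A_p = {0, 1, …, p - 1}`. -/
abbrev Digit (b : RationalBase) : Type := Fin b.p

/-- The evaluation of a word `a_k ⋯ a_1 a_0` (most significant digit first), that is
`∑ i, (a_i / q) * (p / q) ^ i`. -/
def val (b : RationalBase) : List b.Digit → ℚ
  | [] => 0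
  | a :: u => ((a : ℕ) : ℚ) / b.q * ((b.p : ℚ) / b.q) ^ u.length + b.val u

variable (b : RationalBase)

theorem q_pos : (0 : ℚ) < b.q := by
  have h := b.one_lt_q
  exact_mod_cast (by omega : 0 < b.q)

theorem p_pos : (0 : ℚ) < b.p := by
  have h₁ := b.one_lt_q
  have h₂ := b.q_lt_p
  exact_mod_cast (by omega : 0 < b.p)

theorem val_concat (u : List b.Digit) (a : b.Digit) :
    b.val (u ++ [a]) = (b.val u * b.p + (a : ℕ)) / b.q := by
  have hq := b.q_pos.ne'
  induction u with
  | nil => simp [val]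
  | cons c u ih =>
    simp only [List.cons_append, val, ih, List.length_append, List.length_singleton, pow_succ]
    field_simp
    ring

theorem natCast_mem_range (s : ℕ) : (s : ℚ) ∈ Set.range b.val := by
  have hq := b.q_pos.ne'
  induction s using Nat.strong_induction_on with
  | _ s ih =>
    rcases Nat.eq_zero_or_pos s with rfl | hs
    · exact ⟨[], by simp [val]⟩
    have hlt : b.q * s / b.p < s :=
      (Nat.div_lt_iff_lt_mul (Nat.pos_of_neZero b.p)).2
        (by rw [mul_comm]; exact Nat.mul_lt_mul_of_pos_left b.q_lt_p hs)
    obtain ⟨u, hu⟩ := ih _ hlt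
    refine ⟨u ++ [⟨b.q * s % b.p, Nat.mod_lt _ (Nat.pos_of_neZero b.p)⟩], ?_⟩
    rw [val_concat, hu, div_eq_iff hq]
    have h := Nat.div_add_mod (b.q * s) b.p
    push_cast [← @Nat.cast_inj ℚ] at h
    linarith

/-- One step of an addition with carry: the sum `t` of two values and a number `r` yields the
digit `r % p` and the carry `r / p`. -/
theorem step_mem_range (t : ℚ) (r : ℕ)
    (h : t + (r / b.p : ℕ) ∈ Set.range b.val) : (t * b.p + r) / b.q ∈ Set.range b.val := by
  obtain ⟨u, hu⟩ := h
  refine ⟨u ++ [⟨r % b.p, Nat.mod_lt _ (Nat.pos_of_neZero b.p)⟩], ?_⟩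
  rw [val_concat, hu]
  have h := Nat.div_add_mod r b.p
  push_cast [← @Nat.cast_inj ℚ] at h
  congr 1
  linarith

theorem val_add_nat_mem_range (v : List b.Digit) (s : ℕ) :
    b.val v + s ∈ Set.range b.val := by
  have hq := b.q_pos.ne'
  induction v using List.reverseRecOn generalizing s with
  | nil => simpa [val] using b.natCast_mem_range s
  | append_singleton v a ih =>
    have h := b.step_mem_range (b.val v) (a + b.q * s) (ih _)
    rw [val_concat]
    convert h using 1
    push_cast
    field_simp
    ring

theorem val_add_val_add_nat_mem_range (u v : List b.Digit) (s : ℕ) :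
    b.val u + b.val v + s ∈ Set.range b.val := by
  have hq := b.q_pos.ne'
  induction u using List.reverseRecOn generalizing v s with
  | nil => simpa [val] using b.val_add_nat_mem_range v s
  | append_singleton u a ih =>
    rcases List.eq_nil_or_concat v with rfl | ⟨v, c, rfl⟩
    · simpa [val] using b.val_add_nat_mem_range (u ++ [a]) s
    · have h := b.step_mem_range (b.val u + b.val v) (a + c + b.q * s) (ih _ _)
      rw [List.concat_eq_append, val_concat, val_concat]
      convert h using 1
      push_cast
      field_simp
      ring

/-- The set `N_{p/q}` of the evaluations of all words over `A_p`, with its addition. -/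
def N : AddSubmonoid ℚ where
  carrier := Set.range b.val
  zero_mem' := ⟨[], rfl⟩
  add_mem' := by
    rintro _ _ ⟨u, rfl⟩ ⟨v, rfl⟩
    simpa using b.val_add_val_add_nat_mem_range u v 0

theorem mem_N {x : ℚ} : x ∈ b.N ↔ ∃ u, b.val u = x := Iff.rfl

/-! ### Representations -/

theorem exists_rep (x : b.N) : ∃ u : List b.Digit, b.val u = x ∧ u.head? ≠ some 0 := by
  obtain ⟨x, u, rfl⟩ := x
  induction u with
  | nil => exact ⟨[], rfl, by simp⟩
  | cons a u ih =>
    by_cases ha : a = 0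
    · obtain ⟨w, hw, hw₀⟩ := ih
      exact ⟨w, by simp [hw, val, ha], hw₀⟩
    · exact ⟨a :: u, rfl, by simpa using ha⟩

/-- The representation of `x`: the expansion of `x` that does not start with the digit `0`. -/
noncomputable def rep (x : b.N) : List b.Digit := (b.exists_rep x).choose

theorem val_injective {u v : List b.Digit} (h : b.val u = b.val v)
    (hl : u.length = v.length) : u = v := by
  have hq := b.q_pos.ne'
  have key : ∀ w : List b.Digit, ∃ m : ℕ, b.val w * (b.q : ℚ) ^ w.length = m := by
    intro w
    induction w using List.reverseRecOn with
    | nil => exact ⟨0, by simp [val]⟩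
    | append_singleton w a ih =>
      obtain ⟨m, hm⟩ := ih
      refine ⟨m * b.p + a * b.q ^ w.length, ?_⟩
      rw [val_concat]
      push_cast
      rw [← hm, List.length_append, List.length_singleton, pow_succ]
      field_simp
  induction u using List.reverseRecOn generalizing v with
  | nil => exact (List.eq_nil_of_length_eq_zero (by simpa using hl.symm)).symm
  | append_singleton u a ih =>
    rcases List.eq_nil_or_concat v with rfl | ⟨v, c, rfl⟩
    · simp at hl
    have hl' : u.length = v.length := by simpa using hl
    obtain ⟨m, hm⟩ := key u
    obtain ⟨n, hn⟩ := key v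
    rw [List.concat_eq_append, val_concat, val_concat, div_left_inj' hq] at h
    have hz : m * b.p + a * b.q ^ u.length = n * b.p + c * b.q ^ u.length := by
      have : (m * b.p + (a : ℕ) * b.q ^ u.length : ℚ)
          = n * b.p + (c : ℕ) * b.q ^ u.length := by
        rw [← hm, ← hn, ← hl']
        linear_combination (b.q : ℚ) ^ u.length * h
      exact_mod_cast this
    have hmod : (a : ℕ) * b.q ^ u.length ≡ c * b.q ^ u.length [MOD b.p] := by
      have h₁ : m * b.p + a * b.q ^ u.length ≡ (a : ℕ) * b.q ^ u.length [MOD b.p] := by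
        simp [Nat.ModEq]
      have h₂ : n * b.p + c * b.q ^ u.length ≡ (c : ℕ) * b.q ^ u.length [MOD b.p] := by
        simp [Nat.ModEq]
      exact (h₁.symm.trans (by rw [hz])).trans h₂
    have hac : a = c := by
      have := Nat.ModEq.cancel_right_of_coprime (Nat.Coprime.pow_right _ b.coprime) hmod
      exact Fin.ext (Nat.ModEq.eq_of_lt_of_lt this a.2 c.2)
    subst hac
    have hv : b.val u = b.val v := by
      have := b.p_pos.ne'
      exact mul_right_cancel₀ this (by linarith)
    rw [ih hv hl', List.concat_eq_append]

/-- `rep x` is the only expansion of `x` that does not start with `0`. -/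
theorem eq_rep_iff (x : b.N) (u : List b.Digit) :
    u = b.rep x ↔ b.val u = x ∧ u.head? ≠ some 0 := by
  have hspec := (b.exists_rep x).choose_spec
  have hpad : ∀ (k : ℕ) (w : List b.Digit), b.val (List.replicate k 0 ++ w) = b.val w := by
    intro k w
    induction k with
    | zero => simp
    | succ k ih => simp [List.replicate_succ, val, ih]
  have main : ∀ v w : List b.Digit, b.val v = b.val w → v.head? ≠ some 0 →
      w.length ≤ v.length → v = w := by
    intro v w h hv hle
    obtain ⟨k, hk⟩ := Nat.exists_eq_add_of_le hle
    have := b.val_injective (u := v) (v := List.replicate k 0 ++ w) (by rw [hpad, h])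
      (by simp [hk, add_comm])
    rcases k with _ | k
    · simpa using this
    · rw [this] at hv
      simp [List.replicate_succ] at hv
  refine ⟨fun h => h ▸ hspec, fun ⟨h, h₀⟩ => ?_⟩
  rcases le_total (b.rep x).length u.length with hle | hle
  · exact main _ _ (h.trans hspec.1.symm) h₀ hle
  · exact (main _ _ (hspec.1.trans h.symm) hspec.2 hle).symm

/-- The letters `(A_p)^d` read by an automaton with `d` tapes. -/
abbrev Letter (d : ℕ) : Type := Fin d → b.Digit

/-- `u` represents the tuple `x`: it does not start with the letter `(0, …, 0)`, and each
component `u_i` belongs to `0* · rep (x i)`. -/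
def IsTupleRep {d : ℕ} (x : Fin d → b.N) (u : List (b.Letter d)) : Prop :=
  u.head? ≠ some 0 ∧ ∀ i, ∃ k, u.map (fun a => a i) = List.replicate k 0 ++ b.rep (x i)

/-- The language `(0, …, 0)* · rep(S)` of the representations of the elements of `S`,
padded with leading zeros. -/
def paddedRep {d : ℕ} (S : Set (Fin d → b.N)) : Language (b.Letter d) :=
  {w | ∃ x ∈ S, ∃ u, b.IsTupleRep x u ∧ ∃ k, w = List.replicate k 0 ++ u}

/-! ### Automata -/

/-- A finite deterministic automaton with `d` tapes over `A_p`. The transition function may be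
partial, and the words are read from left to right or from right to left. -/
structure TapeAutomaton (d : ℕ) where
  State : Type
  finite : Finite State
  start : State
  step : State → b.Letter d → Option State
  final : Set State
  rightToLeft : Bool

namespace TapeAutomaton

variable {b} {d : ℕ} (A : b.TapeAutomaton d)

/-- The state reached from `s` after the letters of a list have been read in the order of the
list, if that run exists. -/
def runFrom : A.State → List (b.Letter d) → Option A.State
  | s, [] => some s
  | s, a :: u => (A.step s a).bind fun t => runFrom t u

/-- The language accepted by `A`. -/
def accepts : Language (b.Letter d) :=
  {u | ∃ s ∈ A.final, A.runFrom A.start (if A.rightToLeft then u.reverse else u) = some s}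

/-- `A` is padded: leading letters `(0, …, 0)` do not affect acceptance. -/
def IsPadded : Prop :=
  ∀ u : List (b.Letter d), u ∈ A.accepts ↔ 0 :: u ∈ A.accepts

/-- `A` realises `S`. -/
def Realises (S : Set (Fin d → b.N)) : Prop := A.accepts = b.paddedRep S

end TapeAutomaton

/-- A subset of `(N_{p/q})^d` is `p/q`-recognisable if some padded automaton realises it. -/
def IsRecognisable {d : ℕ} (S : Set (Fin d → b.N)) : Prop :=
  ∃ A : b.TapeAutomaton d, A.IsPadded ∧ A.Realises S

/-! ### The function `V_{p/q}` and the representation-length preorder -/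

theorem pow_mem_N (i : ℕ) : ((b.p : ℚ) / b.q) ^ i ∈ b.N := by
  have hq := b.q_pos.ne'
  have h0 : ∀ k : ℕ, b.val (List.replicate k 0) = 0 := by
    intro k
    induction k with
    | zero => rfl
    | succ k ih => simp [List.replicate_succ, val, ih]
  exact ⟨⟨b.q, b.q_lt_p⟩ :: List.replicate i 0, by simp [val, h0, div_self hq]⟩

theorem exists_mul_pow_eq {x : ℚ} (hx : x ∈ b.N) : ∃ k m : ℕ, x * (b.q : ℚ) ^ k = m := by
  have hq := b.q_pos.ne'
  obtain ⟨u, rfl⟩ := hx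
  induction u using List.reverseRecOn with
  | nil => exact ⟨0, 0, by simp [val]⟩
  | append_singleton w a ih =>
    obtain ⟨k, m, hm⟩ := ih
    refine ⟨k + 1, m * b.p + a * b.q ^ k, ?_⟩
    rw [val_concat]
    push_cast
    rw [← hm, pow_succ]
    field_simp

/-- A nonzero element of `N_{p/q}` has a largest divisor among the powers of `p / q`. -/
theorem exists_isGreatest_pow (x : b.N) (hx : x ≠ 0) :
    ∃ y : b.N, IsGreatest
      {y : b.N | (∃ i : ℕ, (y : ℚ) = ((b.p : ℚ) / b.q) ^ i) ∧ (x : ℚ) * (y : ℚ)⁻¹ ∈ b.N} y := by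
  classical
  have hq := b.q_pos.ne'
  have hp := b.p_pos.ne'
  have hr : (1 : ℚ) ≤ (b.p : ℚ) / b.q := by
    rw [one_le_div b.q_pos]
    exact_mod_cast b.q_lt_p.le
  obtain ⟨k, m, hm⟩ := b.exists_mul_pow_eq x.2
  have hm0 : 0 < m := by
    rcases Nat.eq_zero_or_pos m with rfl | h
    · have h0 : (x : ℚ) * (b.q : ℚ) ^ k = 0 := by simpa using hm
      rcases mul_eq_zero.1 h0 with h | h
      · exact absurd (Subtype.ext h) hx
      · exact absurd h (pow_ne_zero _ hq)
    · exact h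
  have hbound : ∀ i : ℕ, (x : ℚ) * (((b.p : ℚ) / b.q) ^ i)⁻¹ ∈ b.N → i ≤ m := by
    intro i hi
    obtain ⟨l, n, hn⟩ := b.exists_mul_pow_eq hi
    have hz : m * b.q ^ (i + l) = n * b.q ^ k * b.p ^ i := by
      have : (m * (b.q : ℚ) ^ (i + l)) = n * b.q ^ k * b.p ^ i := by
        rw [← hm, ← hn, div_pow, pow_add]
        field_simp
      exact_mod_cast this
    have hdvd : b.p ^ i ∣ m :=
      (Nat.Coprime.pow i (i + l) b.coprime).dvd_of_dvd_mul_right ⟨n * b.q ^ k, by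
        rw [hz, mul_comm]⟩
    have h₁ := b.one_lt_q
    have h₂ := b.q_lt_p
    exact ((Nat.lt_pow_self (by omega : 1 < b.p)).le).trans (Nat.le_of_dvd hm0 hdvd)
  set P : ℕ → Prop := fun i => (x : ℚ) * (((b.p : ℚ) / b.q) ^ i)⁻¹ ∈ b.N with hP
  have h0 : P 0 := by simp [hP]
  refine ⟨⟨_, b.pow_mem_N (Nat.findGreatest P m)⟩, ⟨⟨_, rfl⟩, ?_⟩, ?_⟩
  · exact Nat.findGreatest_spec (P := P) (Nat.zero_le m) h0
  · rintro ⟨y, hy⟩ ⟨⟨i, rfl : y = _⟩, hi⟩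
    exact pow_le_pow_right₀ hr (Nat.le_findGreatest (hbound i hi) hi)

open Classical in
/-- `V_{p/q}` maps `0` to `0`, and `x ≠ 0` to the largest power `y` of `p / q` such that `x / y`
belongs to `N_{p/q}`. -/
noncomputable def V (x : b.N) : b.N :=
  if hx : x = 0 then 0 else (b.exists_isGreatest_pow x hx).choose

/-- The representation-length preorder. -/
def LengthLE (x y : b.N) : Prop := (b.rep x).length ≤ (b.rep y).length

/-! ### First-order logic -/

/-- The function symbols `+` (binary) and `V_{p/q}` (unary). -/
inductive LogicFunc : ℕ → Type
  | add : LogicFunc 2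
  | V : LogicFunc 1

/-- The relation symbol `⪯` (binary). -/
inductive LogicRel : ℕ → Type
  | lengthLE : LogicRel 2

/-- The first-order language with symbols `+`, `V_{p/q}` and `⪯` (and equality). -/
def logic : FirstOrder.Language where
  Functions := LogicFunc
  Relations := LogicRel

/-- The structure `⟨N_{p/q}, +, V_{p/q}, ⪯⟩`. -/
noncomputable instance instStructureN : logic.Structure b.N where
  funMap
    | LogicFunc.add, x => x 0 + x 1
    | LogicFunc.V, x => b.V (x 0)
  RelMap
    | LogicRel.lengthLE, x => b.LengthLE (x 0) (x 1)

/-- A subset of `(N_{p/q})^d` is `p/q`-definable if it is defined, without parameters, by a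
first-order formula over `⟨N_{p/q}, +, V_{p/q}, ⪯⟩`. -/
def IsDefinable {d : ℕ} (S : Set (Fin d → b.N)) : Prop :=
  (∅ : Set b.N).Definable logic S

end RationalBase

namespace RationalBase

variable (b : RationalBase)

/-! ### Words and their values -/

/-! Both notions are compared with a third, `Automatic`: the words whose tuple of values satisfies
the predicate form a regular language. Values ignore leading zeros and regular languages are closed
under reversal, so this is recognisability (`isRecognisable_iff_automatic`), and each relation may
be read in whichever direction suits it.

Definable predicates are automatic by induction on formulas. Connectives are Boolean operations on
languages; a quantifier is a projection followed by the removal of leading zeros (`Automatic.ex`).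
Among the atoms, addition is a right-to-left computation with bounded carry (`automatic_linear`),
`V` locates the lowest nonzero digit (`automatic_V`), and the length comparison is settled by the
first nonzero letter (`automatic_lengthLE`).

The converse is Büchi's coding of runs. The elements written `1 0 ⋯ 0` are definable and serve as
positions; the successor of a position and the digit of `x` at a position are definable too
(`unit_succ_iff`, `hasDigit_iff`). Every word over the alphabet is an expansion of some element of
`N`, so an element can code any finite set of positions, and a run is coded by one element per
state. The existence of an accepting run is then a first-order statement
(`Automatic.definablePred`). -/

theorem val_replicate_zero_append (k : ℕ) (w : List b.Digit) :
    b.val (List.replicate k 0 ++ w) = b.val w := by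
  induction k with
  | zero => simp
  | succ k ih => simp [List.replicate_succ, val, ih]

theorem val_replicate_zero (k : ℕ) : b.val (List.replicate k 0) = 0 := by
  simpa [val] using b.val_replicate_zero_append k []

theorem val_append (u v : List b.Digit) :
    b.val (u ++ v) = b.val u * ((b.p : ℚ) / b.q) ^ v.length + b.val v := by
  induction u with
  | nil => simp [val]
  | cons a u ih => simp [val, ih, pow_add]; ring

/-- The value of a word, as an element of `N`. -/
def valN (u : List b.Digit) : b.N := ⟨b.val u, u, rfl⟩

@[simp] theorem coe_valN (u : List b.Digit) : (b.valN u : ℚ) = b.val u := rfl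

theorem val_rep (x : b.N) : b.val (b.rep x) = x := ((b.eq_rep_iff x _).1 rfl).1

theorem valN_rep (x : b.N) : b.valN (b.rep x) = x := Subtype.ext (b.val_rep x)

theorem rep_valN {u : List b.Digit} (h : u.head? ≠ some 0) : b.rep (b.valN u) = u :=
  ((b.eq_rep_iff _ _).2 ⟨rfl, h⟩).symm

theorem valN_zero_cons (u : List b.Digit) : b.valN (0 :: u) = b.valN u :=
  Subtype.ext (by simp [val])

theorem exists_eq_replicate_append_rep (u : List b.Digit) :
    ∃ k, u = List.replicate k 0 ++ b.rep (b.valN u) := by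
  induction u with
  | nil => exact ⟨0, by rw [rep_valN _ (by simp)]; rfl⟩
  | cons a u ih =>
    by_cases ha : a = 0
    · obtain ⟨k, hk⟩ := ih
      refine ⟨k + 1, ?_⟩
      rw [ha, valN_zero_cons, List.replicate_succ, List.cons_append, ← hk]
    · exact ⟨0, by rw [rep_valN _ (by simpa using ha)]; rfl⟩

theorem length_rep_valN_le (u : List b.Digit) : (b.rep (b.valN u)).length ≤ u.length := by
  obtain ⟨k, hk⟩ := b.exists_eq_replicate_append_rep u
  conv_rhs => rw [hk]
  simp

theorem length_rep_valN_cons {a : b.Digit} (ha : a ≠ 0) (u : List b.Digit) :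
    (b.rep (b.valN (a :: u))).length = u.length + 1 := by
  rw [rep_valN _ (by simpa using ha)]; rfl

/-- The digit of position `i` (counted from the right) of the representation of `x`. -/
noncomputable def digit (x : b.N) (i : ℕ) : b.Digit := (b.rep x).reverse.getD i 0

variable {b} {α β γ : Type}

/-- The tuple of the values of the components of a word. -/
def tupleVal (w : List (α → b.Digit)) : α → b.N := fun i => b.valN (w.map fun a => a i)

theorem coe_tupleVal_append_singleton (w : List (α → b.Digit)) (a : α → b.Digit) (i : α) :
    (tupleVal (w ++ [a]) i : ℚ) = (tupleVal w i * b.p + (a i : ℕ)) / b.q := by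
  simp [tupleVal, val_concat]

theorem tupleVal_replicate_zero_append (k : ℕ) (w : List (α → b.Digit)) :
    tupleVal (List.replicate k 0 ++ w) = tupleVal w := by
  ext i
  simp [tupleVal, val_replicate_zero_append]

theorem tupleVal_zero_cons (w : List (α → b.Digit)) : tupleVal (0 :: w) = tupleVal w :=
  tupleVal_replicate_zero_append 1 w

theorem tupleVal_map_comp (f : α → β) (w : List (β → b.Digit)) :
    tupleVal (w.map fun a => a ∘ f) = tupleVal w ∘ f := by
  ext i
  simp [tupleVal, Function.comp_def]

theorem eq_of_tupleVal_eq {u v : List (α → b.Digit)} (h : tupleVal u = tupleVal v)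
    (hl : u.length = v.length) : u = v := by
  have key : ∀ i, (u.map fun a => a i) = v.map fun a => a i := fun i =>
    b.val_injective (congrArg Subtype.val (congrFun h i)) (by simpa using hl)
  refine List.ext_getElem hl fun n h₁ h₂ => funext fun i => ?_
  have := List.getElem_of_eq (key i) (i := n) (by simpa using h₁)
  simpa using this

/-- The word of length `n` whose components are the last `n` digits of the given elements. -/
noncomputable def word (x : α → b.N) (n : ℕ) : List (α → b.Digit) :=
  ((List.range n).map fun i j => b.digit (x j) i).reverse

@[simp] theorem length_word (x : α → b.N) (n : ℕ) : (word x n).length = n := by simp [word]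

theorem word_comp (f : α → β) (x : β → b.N) (n : ℕ) :
    (word x n).map (fun a => a ∘ f) = word (x ∘ f) n := by
  simp [word, Function.comp_def]

theorem map_range_digit (x : b.N) {n : ℕ} (h : (b.rep x).length ≤ n) :
    ((List.range n).map (b.digit x)).reverse
      = List.replicate (n - (b.rep x).length) 0 ++ b.rep x := by
  rw [List.reverse_eq_iff, List.reverse_append, List.reverse_replicate]
  refine List.ext_getElem (by simp; omega) fun m h₁ h₂ => ?_
  simp only [List.getElem_map, List.getElem_range, digit]
  by_cases hm : m < (b.rep x).length
  · rw [List.getElem_append_left (by simpa using hm), List.getD_eq_getElem]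
  · rw [List.getElem_append_right (by simpa using hm), List.getElem_replicate,
      List.getD_eq_default _ _ (by simpa using hm)]

theorem tupleVal_word {x : α → b.N} {n : ℕ} (h : ∀ i, (b.rep (x i)).length ≤ n) :
    tupleVal (word x n) = x := by
  ext i
  have := b.map_range_digit (x i) (h i)
  simp only [tupleVal, word, coe_valN, List.map_reverse, List.map_map, Function.comp_def]
  rw [this, val_replicate_zero_append, val_rep]

theorem word_tupleVal (w : List (α → b.Digit)) {n : ℕ} (h : w.length ≤ n) :
    word (tupleVal w) n = List.replicate (n - w.length) 0 ++ w := by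
  refine eq_of_tupleVal_eq ?_ (by simp; omega)
  rw [tupleVal_replicate_zero_append, tupleVal_word fun i => ?_]
  exact (b.length_rep_valN_le _).trans (by simpa using h)

theorem exists_forall_length_rep_le [Finite α] (x : α → b.N) :
    ∃ n, ∀ i, (b.rep (x i)).length ≤ n := by
  obtain ⟨n, hn⟩ := (Set.finite_range fun i => (b.rep (x i)).length).bddAbove
  exact ⟨n, fun i => hn ⟨i, rfl⟩⟩

theorem exists_eq_replicate_append {A : Type*} [Zero A] (w : List A) :
    ∃ k u, u.head? ≠ some 0 ∧ w = List.replicate k 0 ++ u := by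
  induction w with
  | nil => exact ⟨0, [], by simp, rfl⟩
  | cons a w ih =>
    by_cases ha : a = 0
    · obtain ⟨k, u, hu, rfl⟩ := ih
      exact ⟨k + 1, u, hu, by simp [ha, List.replicate_succ]⟩
    · exact ⟨0, a :: w, by simpa using ha, rfl⟩

theorem isTupleRep_iff {d : ℕ} (x : Fin d → b.N) (u : List (b.Letter d)) :
    b.IsTupleRep x u ↔ u.head? ≠ some 0 ∧ tupleVal u = x := by
  refine and_congr_right fun _ => ⟨fun h => ?_, ?_⟩
  · ext i
    obtain ⟨k, hk⟩ := h i
    simp only [tupleVal, coe_valN]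
    rw [hk, val_replicate_zero_append, val_rep]
  · rintro rfl i
    exact b.exists_eq_replicate_append_rep _

/-- Padding disappears here: the language to be recognised is the full preimage of `S` under
`tupleVal`. -/
theorem mem_paddedRep {d : ℕ} (S : Set (Fin d → b.N)) (w : List (b.Letter d)) :
    w ∈ b.paddedRep S ↔ tupleVal w ∈ S := by
  constructor
  · rintro ⟨x, hx, u, hu, k, rfl⟩
    rw [tupleVal_replicate_zero_append, ((isTupleRep_iff _ _).1 hu).2]
    exact hx
  · intro h
    obtain ⟨k, u, hu, rfl⟩ := exists_eq_replicate_append w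
    rw [tupleVal_replicate_zero_append] at h
    exact ⟨_, h, u, (isTupleRep_iff _ _).2 ⟨hu, rfl⟩, k, rfl⟩

end RationalBase

/-! ### Regularity criteria -/

/-- Myhill–Nerode: `F` contains every left quotient of `L`. The members of `F` play the role of
states, which avoids building automata by hand. -/
theorem Language.isRegular_of_leftQuotient_mem {A : Type*} {F : Set (Language A)} (hF : F.Finite)
    (h : ∀ L ∈ F, ∀ a, L.leftQuotient [a] ∈ F) {L : Language A} (hL : L ∈ F) :
    L.IsRegular := by
  refine .of_finite_range_leftQuotient (hF.subset ?_)
  rintro _ ⟨x, rfl⟩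
  induction x using List.reverseRecOn with
  | nil => exact hL
  | append_singleton x a ih =>
    rw [Language.leftQuotient_append]
    exact h _ ih a

/-- The same criterion for reading from right to left, the direction in which carries propagate. -/
theorem Language.isRegular_of_rightQuotient_mem {A : Type*} {F : Set (Language A)} (hF : F.Finite)
    (h : ∀ L ∈ F, ∀ a, ∃ L' ∈ F, ∀ w, w ++ [a] ∈ L ↔ w ∈ L') {L : Language A} (hL : L ∈ F) :
    L.IsRegular := by
  refine .of_reverse (Language.isRegular_of_leftQuotient_mem (hF.image Language.reverse) ?_
    ⟨L, hL, rfl⟩)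
  rintro _ ⟨L, hL, rfl⟩ a
  obtain ⟨L', hL', h'⟩ := h L hL a
  refine ⟨L', hL', ?_⟩
  ext w
  simp [← h']

/-- The words that become members of `L` after some letters that `f` maps to `z` are prefixed and
the letters are mapped by `f`. -/
theorem Language.IsRegular.map_leftQuotient_star {A B : Type} (f : A → B) (z : B)
    {L : Language A} (hL : L.IsRegular) :
    Language.IsRegular
      ({w | ∃ k, ∃ w' ∈ L, w'.map f = List.replicate k z ++ w} : Language B) := by
  obtain ⟨σ, _, M, rfl⟩ := hL
  -- Nondeterminism guesses a preimage of each letter; the start states are those reachable by words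
  -- mapped to `z ⋯ z`, so the prefix is consumed before reading begins.
  let M' : NFA B σ :=
    { step := fun s a => {t | ∃ c, f c = a ∧ M.step s c = t}
      start := {s | ∃ k w', w'.map f = List.replicate k z ∧ M.eval w' = s}
      accept := M.accept }
  have key : ∀ w s, s ∈ M'.eval w ↔
      ∃ k w', w'.map f = List.replicate k z ++ w ∧ M.eval w' = s := by
    intro w
    induction w using List.reverseRecOn with
    | nil => intro s; simp [M']
    | append_singleton w a ih =>
      intro s
      rw [NFA.eval_append_singleton, NFA.mem_stepSet]
      constructor
      · rintro ⟨t, ht, c, rfl, rfl⟩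
        obtain ⟨k, w', hw', rfl⟩ := (ih t).1 ht
        exact ⟨k, w' ++ [c], by simp [hw'], by simp⟩
      · rintro ⟨k, w', hw', rfl⟩
        rw [← List.append_assoc, List.map_eq_append_iff] at hw'
        obtain ⟨u, v, rfl, hu, hv⟩ := hw'
        obtain ⟨c, rfl, rfl⟩ := List.map_eq_singleton_iff.1 hv
        exact ⟨_, (ih _).2 ⟨k, u, hu, rfl⟩, c, rfl, by simp⟩
  refine Language.isRegular_iff.2 ⟨Set σ, inferInstance, M'.toDFA, ?_⟩
  rw [NFA.toDFA_correct]
  ext w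
  constructor
  · rintro ⟨s, hs, hw⟩
    obtain ⟨k, w', h, rfl⟩ := (key w s).1 hw
    exact ⟨k, w', hs, h⟩
  · rintro ⟨k, w', hw', h⟩
    exact ⟨_, hw', (key w _).2 ⟨k, w', h, rfl⟩⟩

namespace RationalBase

variable {b : RationalBase} {α β γ : Type}

/-! ### Automatic predicates -/

/-- The words over `(A_p)^α` whose value satisfies `P`. -/
def words (P : (α → b.N) → Prop) : Language (α → b.Digit) := {w | P (tupleVal w)}

@[simp] theorem mem_words {P : (α → b.N) → Prop} {w : List (α → b.Digit)} :
    w ∈ words P ↔ P (tupleVal w) := Iff.rfl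

/-- A predicate is automatic if the words whose value satisfies it form a regular language. -/
def Automatic (P : (α → b.N) → Prop) : Prop := (words P).IsRegular

theorem Automatic.congr {P Q : (α → b.N) → Prop} (hP : Automatic P) (h : ∀ v, P v ↔ Q v) :
    Automatic Q := by
  rwa [show Q = P from funext fun v => propext (h v).symm]

theorem Automatic.not {P : (α → b.N) → Prop} (hP : Automatic P) : Automatic fun v => ¬ P v :=
  Language.IsRegular.compl hP

theorem Automatic.and {P Q : (α → b.N) → Prop} (hP : Automatic P) (hQ : Automatic Q) :
    Automatic fun v => P v ∧ Q v :=
  Language.IsRegular.inf hP hQ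

theorem Automatic.imp {P Q : (α → b.N) → Prop} (hP : Automatic P) (hQ : Automatic Q) :
    Automatic fun v => P v → Q v :=
  (hP.and hQ.not).not.congr fun v => by tauto

theorem Automatic.comp {P : (α → b.N) → Prop} (hP : Automatic P) (f : α → β) :
    Automatic fun v : β → b.N => P (v ∘ f) := by
  obtain ⟨σ, _, M, hM⟩ := hP
  refine ⟨σ, inferInstance, M.comap fun a => a ∘ f, ?_⟩
  rw [DFA.accepts_comap, hM]
  ext w
  change P (tupleVal (w.map _)) ↔ P (tupleVal w ∘ f)
  rw [tupleVal_map_comp]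

/-- A witness may be longer than the word that carries `v`. The projection of a common word then has
extra leading zeros, which have to be removed as well. -/
theorem Automatic.ex [Finite α] [Finite β] {P : (α ⊕ β → b.N) → Prop} (hP : Automatic P) :
    Automatic fun v : α → b.N => ∃ u : β → b.N, P (Sum.elim v u) := by
  have := Language.IsRegular.map_leftQuotient_star
    (fun a : α ⊕ β → b.Digit => a ∘ Sum.inl) (0 : α → b.Digit) hP
  refine (congrArg Language.IsRegular ?_).mpr this
  ext w
  constructor
  · rintro ⟨u, hu⟩
    obtain ⟨n, hn⟩ := exists_forall_length_rep_le (Sum.elim (tupleVal w) u)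
    have hn' := fun i => (hn i).trans (le_max_left n w.length)
    refine ⟨max n w.length - w.length, word (Sum.elim (tupleVal w) u) (max n w.length), ?_, ?_⟩
    · rwa [mem_words, tupleVal_word hn']
    · rw [word_comp, Sum.elim_comp_inl, word_tupleVal w (le_max_right _ _)]
  · rintro ⟨k, w', hw', h⟩
    refine ⟨tupleVal w' ∘ Sum.inr, ?_⟩
    have : tupleVal w = tupleVal w' ∘ Sum.inl := by
      rw [← tupleVal_map_comp, h, tupleVal_replicate_zero_append]
    rw [this, Sum.elim_comp_inl_inr]
    exact hw'

theorem Automatic.all [Finite α] [Finite β] {P : (α ⊕ β → b.N) → Prop} (hP : Automatic P) :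
    Automatic fun v : α → b.N => ∀ u : β → b.N, P (Sum.elim v u) :=
  hP.not.ex.not.congr fun v => by simp

/-! ### Linear relations -/

theorem exists_mul_pow_eq_int (x : b.N) : ∃ k : ℕ, ∃ m : ℤ, (x : ℚ) * (b.q : ℚ) ^ k = m := by
  obtain ⟨k, m, h⟩ := b.exists_mul_pow_eq x.2
  exact ⟨k, m, by simpa using h⟩

theorem exists_sum_mul_pow_eq_int (c : γ → ℤ) (v : γ → b.N) (s : Finset γ) :
    ∃ k : ℕ, ∃ m : ℤ, (∑ i ∈ s, (c i : ℚ) * v i) * (b.q : ℚ) ^ k = m := by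
  classical
  induction s using Finset.induction_on with
  | empty => exact ⟨0, 0, by simp⟩
  | insert i s hi ih =>
    obtain ⟨k, m, h⟩ := ih
    obtain ⟨l, n, h'⟩ := exists_mul_pow_eq_int (v i)
    refine ⟨k + l, c i * n * b.q ^ k + m * b.q ^ l, ?_⟩
    rw [Finset.sum_insert hi, pow_add]
    push_cast
    rw [← h, ← h']
    ring

/-- Elements of `N` have denominators that are powers of `q`, hence coprime to `p`; so `t / p` can
cancel their combination only if it is an integer. -/
theorem dvd_of_sum_mul_add_div_eq_zero (c : γ → ℤ) (v : γ → b.N) (s : Finset γ) (t : ℤ)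
    (h : (∑ i ∈ s, (c i : ℚ) * v i) + t / b.p = 0) : (b.p : ℤ) ∣ t := by
  obtain ⟨k, m, hm⟩ := exists_sum_mul_pow_eq_int c v s
  have hp := b.p_pos.ne'
  have hz : t * b.q ^ k = b.p * (-m) := by
    have : (t : ℚ) * b.q ^ k = b.p * (-m) := by
      rw [← hm]
      have : (t : ℚ) = - b.p * ∑ i ∈ s, (c i : ℚ) * v i := by
        field_simp at h
        linarith
      rw [this]
      ring
    exact_mod_cast this
  have hco : IsCoprime (b.p : ℤ) ((b.q : ℤ) ^ k) :=
    (Nat.isCoprime_iff_coprime.2 b.coprime).pow_right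
  exact hco.dvd_of_dvd_mul_right ⟨_, hz⟩

/-- The carry rule: a factor `p / q` comes out, and the carry `r` becomes `(∑ c i * a i + q * r) /
p`. -/
theorem sum_tupleVal_append_singleton [Fintype γ] (c : γ → ℤ) (r : ℤ) (w : List (γ → b.Digit))
    (a : γ → b.Digit) :
    ∑ i, (c i : ℚ) * tupleVal (w ++ [a]) i + r = 0 ↔
      ∑ i, (c i : ℚ) * tupleVal w i + ((∑ i, c i * (a i : ℕ) + b.q * r : ℤ) : ℚ) / b.p = 0 := by
  have hp := b.p_pos.ne'
  have hq := b.q_pos.ne'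
  have : ∑ i, (c i : ℚ) * tupleVal (w ++ [a]) i + r
      = (∑ i, (c i : ℚ) * tupleVal w i
        + ((∑ i, c i * (a i : ℕ) + b.q * r : ℤ) : ℚ) / b.p) * (b.p / b.q) := by
    simp only [coe_tupleVal_append_singleton]
    push_cast
    rw [add_mul, Finset.sum_mul, add_div, add_mul, ← add_assoc, Finset.sum_div, Finset.sum_mul,
      ← Finset.sum_add_distrib]
    congr 1
    · refine Finset.sum_congr rfl fun i _ => ?_
      field_simp
    · field_simp
  rw [this, mul_eq_zero, or_iff_left (div_ne_zero hp hq)]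

theorem automatic_linear [Fintype γ] (c : γ → ℤ) :
    Automatic fun v : γ → b.N => ∑ i, (c i : ℚ) * v i = 0 := by
  set K : ℤ := ∑ i, |c i| with hK
  have hK0 : 0 ≤ K := Finset.sum_nonneg fun i _ => abs_nonneg _
  let L : ℤ → Language (γ → b.Digit) :=
    fun r => words fun v => ∑ i, (c i : ℚ) * v i + r = 0
  have hmem : ∀ r w, w ∈ L r ↔ ∑ i, (c i : ℚ) * tupleVal w i + r = 0 := fun _ _ => Iff.rfl
  refine Language.isRegular_of_rightQuotient_mem
    -- Carries stay in this interval: if `|r| ≤ p * K`, then `p * |r'| ≤ K * (p - 1) + q * p * K ≤ p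
    -- * (p * K)` because `q + 1 ≤ p`.
    (F := insert ⊥ (L '' Set.Icc (-(b.p * K)) (b.p * K)))
    (((Set.finite_Icc _ _).image _).insert _) ?_ (Or.inr ⟨0, by constructor <;> nlinarith, ?_⟩)
  · rintro _ (rfl | ⟨r, hr, rfl⟩) a
    · exact ⟨⊥, Or.inl rfl, fun w => Iff.rfl⟩
    · by_cases hd : (b.p : ℤ) ∣ ∑ i, c i * (a i : ℕ) + b.q * r
      · obtain ⟨r', hr'⟩ := hd
        refine ⟨L r', Or.inr ⟨r', ?_, rfl⟩, fun w => ?_⟩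
        · have hsum : |∑ i, c i * ((a i : ℕ) : ℤ)| ≤ K * (b.p - 1) := by
            refine (Finset.abs_sum_le_sum_abs _ _).trans ?_
            rw [hK, Finset.sum_mul]
            refine Finset.sum_le_sum fun i _ => ?_
            rw [abs_mul]
            refine mul_le_mul_of_nonneg_left ?_ (abs_nonneg _)
            have := (a i).2
            rw [abs_of_nonneg (by positivity)]
            omega
          have hqp : (b.q : ℤ) + 1 ≤ b.p := by have := b.q_lt_p; omega
          have hq0 : (0 : ℤ) ≤ b.q := by positivity
          have hp0 : (0 : ℤ) < b.p := by omega
          have hqr : |(b.q : ℤ) * r| ≤ b.q * (b.p * K) := by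
            rw [abs_mul, abs_of_nonneg hq0]
            exact mul_le_mul_of_nonneg_left (abs_le.2 hr) hq0
          have h1 : |(b.p : ℤ) * r'| ≤ K * (b.p - 1) + b.q * (b.p * K) := by
            rw [← hr']
            exact (abs_add_le _ _).trans (add_le_add hsum hqr)
          rw [abs_mul, abs_of_pos hp0] at h1
          have h2 : (b.p : ℤ) * |r'| ≤ b.p * (b.p * K) := by
            have := mul_le_mul_of_nonneg_left hqp (mul_nonneg hp0.le hK0)
            nlinarith
          exact abs_le.1 (le_of_mul_le_mul_left h2 hp0)
        · have hp := b.p_pos.ne'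
          rw [hmem, hmem, sum_tupleVal_append_singleton, hr']
          push_cast
          rw [mul_div_cancel_left₀ _ hp]
      -- A carry that is not an integer cannot be cancelled, so no word remains.
      · refine ⟨⊥, Or.inl rfl, fun w => ?_⟩
        rw [hmem, sum_tupleVal_append_singleton]
        exact ⟨fun h => hd (dvd_of_sum_mul_add_div_eq_zero c _ _ _ h), fun h => h.elim⟩
  · simp [L]

theorem automatic_eq (i j : γ) : Automatic fun v : γ → b.N => v i = v j :=
  ((automatic_linear ![1, -1]).comp ![i, j]).congr fun v => by
    simp [Fin.sum_univ_succ, ← sub_eq_add_neg, sub_eq_zero]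

theorem automatic_add (i j k : γ) : Automatic fun v : γ → b.N => v k = v i + v j :=
  ((automatic_linear ![1, 1, -1]).comp ![i, j, k]).congr fun v => by
    simp only [Subtype.ext_iff, AddSubmonoid.coe_add, eq_comm (a := (v k : ℚ))]
    rw [← sub_eq_zero]
    simp [Fin.sum_univ_succ, ← sub_eq_add_neg]
    rw [← add_sub_assoc, sub_eq_zero]

/-! ### The length preorder -/

/-- Reading from the left, leading zeros on both tapes are skipped. At the first other letter, a
nonzero digit on the second tape settles the matter positively, and a zero there settles it
negatively. -/
theorem automatic_lengthLE (i j : γ) :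
    Automatic fun v : γ → b.N => b.LengthLE (v i) (v j) := by
  refine Automatic.comp (P := fun v => b.LengthLE (v 0) (v 1)) ?_ ![i, j]
  refine Language.isRegular_of_leftQuotient_mem
    (F := {words fun v => b.LengthLE (v 0) (v 1), ⊤, ⊥})
    (Set.toFinite _) ?_ (by simp)
  have htop : ∀ w : List (Fin 2 → b.Digit), w ∈ (⊤ : Language _) := fun w => trivial
  have hbot : ∀ w : List (Fin 2 → b.Digit), w ∉ (⊥ : Language _) := fun w h => h
  rintro _ (rfl | rfl | rfl) a
  · by_cases h1 : a 1 = 0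
    · by_cases h0 : a 0 = 0
      · left
        ext w
        simp only [Language.mem_leftQuotient, mem_words, tupleVal, List.singleton_append,
          List.map_cons, h0, h1, valN_zero_cons]
      · right; right
        ext w
        simp only [Language.mem_leftQuotient, mem_words, tupleVal, List.singleton_append,
          List.map_cons, h1, valN_zero_cons, LengthLE, length_rep_valN_cons _ h0, hbot, iff_false]
        have := b.length_rep_valN_le (w.map fun a => a 1)
        simp only [List.length_map] at this ⊢
        omega
    · right; left
      ext w
      simp only [Language.mem_leftQuotient, mem_words, tupleVal, List.singleton_append,
        List.map_cons, LengthLE, length_rep_valN_cons _ h1, htop, iff_true]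
      have := b.length_rep_valN_le (a 0 :: w.map fun a => a 0)
      simpa using this
  · right; left
    ext w
    simp [htop]
  · right; right
    ext w
    simp [hbot]

/-! ### The function `V` -/

theorem ratio_pos : (0 : ℚ) < (b.p : ℚ) / b.q := div_pos b.p_pos b.q_pos

theorem one_lt_ratio : (1 : ℚ) < (b.p : ℚ) / b.q := by
  rw [one_lt_div b.q_pos]
  exact_mod_cast b.q_lt_p

/-- The value determines the last digit, whatever the lengths: the difference of the two digits is
divisible by `p` and smaller than `p` in absolute value. -/
theorem valN_append_singleton_inj {u v : List b.Digit} {a c : b.Digit} :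
    b.valN (u ++ [a]) = b.valN (v ++ [c]) ↔ b.valN u = b.valN v ∧ a = c := by
  have hp := b.p_pos.ne'
  have hq := b.q_pos.ne'
  constructor
  · intro h
    have h' : b.val u * b.p + (a : ℕ) = b.val v * b.p + (c : ℕ) := by
      have := congrArg Subtype.val h
      simpa only [coe_valN, val_concat, div_left_inj' hq] using this
    have hd := dvd_of_sum_mul_add_div_eq_zero (b := b) ![1, -1] ![b.valN u, b.valN v]
      Finset.univ ((a : ℕ) - (c : ℕ)) (by
        simp [Fin.sum_univ_succ]
        field_simp
        linarith)
    have ha := a.2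
    have hc := c.2
    have hac : a = c := by
      have := Int.eq_zero_of_abs_lt_dvd hd (by rw [abs_lt]; constructor <;> omega)
      exact Fin.ext (by omega)
    subst hac
    exact ⟨Subtype.ext (mul_right_cancel₀ hp (by simpa using h')), rfl⟩
  · rintro ⟨h, rfl⟩
    ext
    have := congrArg Subtype.val h
    simp only [coe_valN] at this ⊢
    rw [val_concat, val_concat, this]

theorem val_append_replicate_zero (u : List b.Digit) (n : ℕ) :
    b.val (u ++ List.replicate n 0) = b.val u * ((b.p : ℚ) / b.q) ^ n := by
  simp [val_append, val_replicate_zero]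

theorem val_append_zero (u : List b.Digit) :
    b.val (u ++ [0]) = b.val u * ((b.p : ℚ) / b.q) := by
  simpa using val_append_replicate_zero u 1

theorem V_zero : b.V 0 = 0 := by simp [V]

theorem V_eq_iff {x y : b.N} (hx : x ≠ 0) : b.V x = y ↔ IsGreatest
    {y : b.N | (∃ i : ℕ, (y : ℚ) = ((b.p : ℚ) / b.q) ^ i) ∧ (x : ℚ) * (y : ℚ)⁻¹ ∈ b.N} y := by
  have h := (b.exists_isGreatest_pow x hx).choose_spec
  rw [V, dif_neg hx]
  exact ⟨fun e => e ▸ h, fun h' => h.unique h'⟩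

/-- Appending a `0` multiplies by `p / q`, so divisibility by `(p / q) ^ i` inside `N` means `i`
trailing zeros. -/
theorem exists_V_eq {x : b.N} (hx : x ≠ 0) :
    ∃ i w, (b.V x : ℚ) = ((b.p : ℚ) / b.q) ^ i ∧ b.valN (w ++ List.replicate i 0) = x := by
  obtain ⟨⟨⟨i, hi⟩, w, hw⟩, -⟩ := (V_eq_iff hx).1 rfl
  refine ⟨i, w, hi, Subtype.ext ?_⟩
  have := (pow_pos (ratio_pos (b := b)) i).ne'
  rw [coe_valN, val_append_replicate_zero, hw, hi, inv_mul_cancel_right₀ this]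

/-- A higher power would give an expansion ending in `0`, against the uniqueness of the last digit.
The right-hand side is the number `1`, written with the digit `q` since evaluation divides by `q`.
-/
theorem V_append_singleton (u : List b.Digit) {a : b.Digit} (ha : a ≠ 0) :
    b.V (b.valN (u ++ [a])) = b.valN [⟨b.q, b.q_lt_p⟩] := by
  have hq := b.q_pos.ne'
  have h1 : (b.valN [⟨b.q, b.q_lt_p⟩] : ℚ) = 1 := by simp [val, hq]
  have h0 : b.valN (u ++ [a]) ≠ 0 := fun h =>
    ha ((valN_append_singleton_inj (v := []) (c := 0)).1
      (h.trans (Subtype.ext (by simp [val])))).2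
  rw [V_eq_iff h0]
  refine ⟨⟨⟨0, h1.trans (pow_zero _).symm⟩, by
    rw [h1, inv_one, mul_one]; exact Subtype.property _⟩, ?_⟩
  rintro y ⟨⟨j, hj⟩, w, hw⟩
  rcases j with _ | j
  · rw [← Subtype.coe_le_coe, h1, hj, pow_zero]
  · refine absurd ((valN_append_singleton_inj (u := u) (a := a) (v := w ++ List.replicate j 0)
      (c := 0)).1 (Subtype.ext ?_)).2 ha
    have := (pow_pos (ratio_pos (b := b)) (j + 1)).ne'
    rw [hj] at hw
    rw [List.append_assoc, ← List.replicate_succ', coe_valN _ (w ++ _), val_append_replicate_zero,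
      hw, inv_mul_cancel_right₀ this]

theorem coe_V_append_zero (u : List b.Digit) :
    (b.V (b.valN (u ++ [0])) : ℚ) = b.V (b.valN u) * ((b.p : ℚ) / b.q) := by
  have hr := ratio_pos (b := b)
  have hp := b.p_pos.ne'
  have hq := b.q_pos.ne'
  have hs : (b.valN (u ++ [0]) : ℚ) = b.valN u * ((b.p : ℚ) / b.q) := val_append_zero u
  by_cases h : b.valN u = 0
  · have : b.valN (u ++ [0]) = 0 := Subtype.ext (by rw [hs, h]; simp)
    simp [this, h, V_zero]
  · have h' : b.valN (u ++ [0]) ≠ 0 := fun h0 => h <| Subtype.ext <| by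
      rw [h0] at hs
      simpa [hr.ne'] using hs.symm
    obtain ⟨⟨⟨i, hi⟩, hm⟩, hub⟩ := (V_eq_iff h).1 rfl
    rw [hi, ← pow_succ]
    suffices b.V (b.valN (u ++ [0])) = ⟨_, b.pow_mem_N (i + 1)⟩ by rw [this]
    rw [V_eq_iff h']
    refine ⟨⟨⟨_, rfl⟩, ?_⟩, ?_⟩
    · rw [hi] at hm
      rw [hs]
      convert hm using 1
      change _ * (((b.p : ℚ) / b.q) ^ (i + 1))⁻¹ = _
      rw [pow_succ]
      field_simp
    · rintro y ⟨⟨j, hj⟩, hy⟩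
      rw [← Subtype.coe_le_coe, hj]
      refine pow_le_pow_right₀ one_lt_ratio.le ?_
      rcases j with _ | j
      · exact Nat.zero_le _
      · have := @hub ⟨_, b.pow_mem_N j⟩ ⟨⟨j, rfl⟩, by
          rw [hs, hj] at hy
          convert hy using 1
          rw [pow_succ]
          field_simp⟩
        rw [← Subtype.coe_le_coe, hi] at this
        exact Nat.succ_le_succ ((pow_le_pow_iff_right₀ one_lt_ratio).1 this)

theorem V_append_zero_eq_iff (u v : List b.Digit) (a : b.Digit) :
    b.V (b.valN (u ++ [0])) = b.valN (v ++ [a]) ↔ b.V (b.valN u) = b.valN v ∧ a = 0 := by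
  have : b.V (b.valN (u ++ [0])) = b.valN (b.rep (b.V (b.valN u)) ++ [0]) := by
    ext
    rw [coe_V_append_zero, coe_valN, val_append_zero, val_rep]
  rw [this, valN_append_singleton_inj, valN_rep, eq_comm (a := (0 : b.Digit))]

/-- Read from the right, common zeros are stripped until the first nonzero digit of the argument;
there the value must have the digit `q`, and only zeros to its left. -/
theorem automatic_V (i j : γ) : Automatic fun v : γ → b.N => v j = b.V (v i) := by
  suffices h : Automatic fun v : Fin 2 → b.N => b.V (v 0) = v 1 from
    (h.comp ![i, j]).congr fun v => eq_comm
  refine Language.isRegular_of_rightQuotient_mem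
    (F := {words fun v => b.V (v 0) = v 1, words fun v => v 1 = 0, ⊥})
    (Set.toFinite _) ?_ (by simp)
  have hbot : ∀ w : List (Fin 2 → b.Digit), w ∉ (⊥ : Language _) := fun w h => h
  rintro _ (rfl | rfl | rfl) a
  · by_cases h0 : a 0 = 0
    · by_cases h1 : a 1 = 0
      · refine ⟨_, Or.inl rfl, fun w => ?_⟩
        simp [tupleVal, h0, V_append_zero_eq_iff, h1]
      · refine ⟨_, Or.inr (Or.inr rfl), fun w => ?_⟩
        simp [tupleVal, h0, V_append_zero_eq_iff, h1, hbot]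
    · by_cases h1 : a 1 = ⟨b.q, b.q_lt_p⟩
      · refine ⟨_, Or.inr (Or.inl rfl), fun w => ?_⟩
        have := valN_append_singleton_inj (b := b) (u := []) (a := ⟨b.q, b.q_lt_p⟩)
          (v := w.map fun a => a 1) (c := a 1)
        simp only [mem_words, tupleVal, List.map_append, List.map_singleton,
          V_append_singleton _ h0]
        rw [List.nil_append] at this
        rw [this, h1]
        exact ⟨fun h => h.1.symm, fun h => ⟨h.symm, rfl⟩⟩
      · refine ⟨_, Or.inr (Or.inr rfl), fun w => ?_⟩
        have := valN_append_singleton_inj (b := b) (u := []) (a := ⟨b.q, b.q_lt_p⟩)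
          (v := w.map fun a => a 1) (c := a 1)
        simp only [mem_words, tupleVal, List.map_append, List.map_singleton,
          V_append_singleton _ h0]
        rw [List.nil_append] at this
        rw [this]
        simp [eq_comm, h1, hbot]
  · have hz : (0 : b.N) = b.valN ([] ++ [0]) := Subtype.ext (by simp [val])
    have hn : b.valN [] = 0 := rfl
    by_cases h1 : a 1 = 0
    · refine ⟨_, Or.inr (Or.inl rfl), fun w => ?_⟩
      simp only [mem_words, tupleVal, List.map_append, List.map_singleton, h1]
      rw [hz, valN_append_singleton_inj, ← hz]
      simp [hn]
    · refine ⟨_, Or.inr (Or.inr rfl), fun w => ?_⟩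
      simp only [mem_words, tupleVal, List.map_append, List.map_singleton]
      rw [hz, valN_append_singleton_inj]
      simp [h1, hbot]
  · exact ⟨_, Or.inr (Or.inr rfl), fun w => Iff.rfl⟩

/-! ### Definable sets are recognisable -/

theorem Automatic.forall_finite [Finite γ] {P : γ → (α → b.N) → Prop}
    (hP : ∀ i, Automatic (P i)) : Automatic fun v => ∀ i, P i v := by
  classical
  have := Fintype.ofFinite γ
  have key : ∀ s : Finset γ, Automatic fun v => ∀ i ∈ s, P i v := by
    intro s
    induction s using Finset.induction_on with
    | empty => exact ((automatic_linear (γ := Fin 0) ![]).comp Fin.elim0).congr (by simp)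
    | insert i s _ ih => exact ((hP i).and ih).congr fun v => by simp
  exact (key Finset.univ).congr fun v => by simp

/-- A function is automatic if its graph is. -/
def AutomaticFun (g : (α → b.N) → b.N) : Prop :=
  Automatic fun v : α ⊕ Unit → b.N => v (Sum.inr ()) = g (v ∘ Sum.inl)

theorem automaticFun_var (i : α) : AutomaticFun fun v : α → b.N => v i :=
  automatic_eq _ _

theorem AutomaticFun.comp {g : (α → b.N) → b.N} (hg : AutomaticFun g) (f : α → β) :
    AutomaticFun fun v : β → b.N => g (v ∘ f) :=
  Automatic.comp hg (Sum.map f id)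

/-- Substitution reduces to projection: the values `g i v` are quantified existentially and
constrained by their graphs. -/
theorem Automatic.subst [Finite α] [Finite γ] {R : (γ → b.N) → Prop} (hR : Automatic R)
    {g : γ → (α → b.N) → b.N} (hg : ∀ i, AutomaticFun (g i)) :
    Automatic fun v => R fun i => g i v := by
  have h : Automatic fun v : α ⊕ γ → b.N => ∀ i, v (Sum.inr i) = g i (v ∘ Sum.inl) :=
    .forall_finite fun i => Automatic.comp (hg i) (Sum.map id fun _ => i)
  refine (h.and (hR.comp Sum.inr)).ex.congr fun v => ⟨?_, fun h => ⟨_, fun i => rfl, h⟩⟩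
  rintro ⟨u, hu, h⟩
  obtain rfl : u = fun i => g i v := funext hu
  exact h

theorem automaticFun_realize [Finite α] (t : logic.Term α) :
    AutomaticFun fun v : α → b.N => t.realize v := by
  induction t with
  | var i => exact automaticFun_var i
  | @func n f ts ih =>
    have hg : ∀ i : Fin n ⊕ Unit, AutomaticFun ((Sum.elim
        (fun i v => (ts i).realize (v ∘ Sum.inl)) fun _ v => v (Sum.inr ()) :
          Fin n ⊕ Unit → (α ⊕ Unit → b.N) → b.N) i) := by
      rintro (i | i)
      · exact (ih i).comp Sum.inl
      · exact automaticFun_var _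
    cases f with
    | add => exact (automatic_add (Sum.inl 0) (Sum.inl 1) (Sum.inr ())).subst hg
    | V => exact (automatic_V (Sum.inl 0) (Sum.inr ())).subst hg

theorem automatic_realize [Finite α] {n : ℕ} (φ : logic.BoundedFormula α n) :
    Automatic fun v : α ⊕ Fin n → b.N => φ.Realize (v ∘ Sum.inl) (v ∘ Sum.inr) := by
  have hterm : ∀ {n : ℕ} (t : logic.Term (α ⊕ Fin n)), AutomaticFun fun v : α ⊕ Fin n → b.N =>
      t.realize (Sum.elim (v ∘ Sum.inl) (v ∘ Sum.inr)) := fun t => by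
    simpa only [Sum.elim_comp_inl_inr] using automaticFun_realize t
  induction φ with
  | falsum =>
    exact (((automatic_linear (γ := Fin 0) ![]).comp Fin.elim0).not).congr fun v => by
      simp [FirstOrder.Language.BoundedFormula.Realize]
  | equal t₁ t₂ =>
    refine (automatic_eq (γ := Bool) true false).subst (g := fun i v => bif i then
      t₁.realize (Sum.elim (v ∘ Sum.inl) (v ∘ Sum.inr)) else
      t₂.realize (Sum.elim (v ∘ Sum.inl) (v ∘ Sum.inr))) ?_
    rintro (_ | _)
    exacts [hterm _, hterm _]
  | rel R ts =>
    cases R with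
    | lengthLE => exact (automatic_lengthLE 0 1).subst fun i => hterm (ts i)
  | imp _ _ ih₁ ih₂ => exact ih₁.imp ih₂
  | @all n φ ih =>
    -- The last of the `n + 1` indexed variables, which the quantifier binds, is moved to a summand
    -- `Unit` of its own so that `Automatic.all` applies.
    have h := ih.comp (Sum.elim (Sum.inl ∘ Sum.inl)
      (Fin.snoc (α := fun _ => (α ⊕ Fin n) ⊕ Unit) (Sum.inl ∘ Sum.inr) (Sum.inr ())))
    refine h.all.congr fun v => ?_
    rw [FirstOrder.Language.BoundedFormula.realize_all]
    have key : ∀ u : Unit → b.N, (Sum.elim v u ∘ Sum.elim (Sum.inl ∘ Sum.inl)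
        (Fin.snoc (α := fun _ => (α ⊕ Fin n) ⊕ Unit) (Sum.inl ∘ Sum.inr) (Sum.inr ()))) ∘ Sum.inr
          = Fin.snoc (α := fun _ => b.N) (v ∘ Sum.inr) (u ()) := fun u => by
      ext i
      refine Fin.lastCases ?_ (fun i => ?_) i <;> simp
    refine ⟨fun h x => ?_, fun h u => ?_⟩
    · have := h fun _ => x
      rwa [key] at this
    · rw [key]
      exact h _

theorem IsDefinable.automatic {d : ℕ} {S : Set (Fin d → b.N)} (hS : b.IsDefinable S) :
    Automatic fun v => v ∈ S := by
  obtain ⟨φ, rfl⟩ := Set.empty_definable_iff.1 hS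
  refine ((automatic_realize φ).comp (Sum.elim id Fin.elim0)).congr fun v => ?_
  rw [Set.mem_ofPred_eq, FirstOrder.Language.Formula.Realize]
  exact iff_of_eq (congrArg _ (Subsingleton.elim _ _))

/-! ### Recognisable sets -/

/-- The state `none` serves as a sink for missing transitions, and closure under reversal absorbs
the reading direction. -/
theorem TapeAutomaton.isRegular_accepts {d : ℕ} (A : b.TapeAutomaton d) :
    A.accepts.IsRegular := by
  have := A.finite
  have := Fintype.ofFinite (Option A.State)
  let M : DFA (b.Letter d) (Option A.State) :=
    ⟨fun s a => s.bind fun t => A.step t a, some A.start, some '' A.final⟩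
  have hM : ∀ (u : List (b.Letter d)) (s : Option A.State),
      M.evalFrom s u = s.bind fun t => A.runFrom t u := by
    intro u
    induction u with
    | nil => intro s; cases s <;> rfl
    | cons a u ih =>
      intro s
      rw [DFA.evalFrom_cons, ih]
      cases s <;> rfl
  have hL : ∀ u, u ∈ M.accepts ↔ ∃ s ∈ A.final, A.runFrom A.start u = some s := by
    intro u
    rw [DFA.mem_accepts, DFA.eval, hM]
    simp [M, eq_comm]
  have hreg : M.accepts.IsRegular := ⟨_, inferInstance, M, rfl⟩
  rcases h : A.rightToLeft with _ | _
  · convert hreg using 1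
    ext u
    rw [hL]
    simp only [TapeAutomaton.accepts, h]
    rfl
  · convert hreg.reverse using 1
    ext u
    rw [Language.mem_reverse, hL]
    simp only [TapeAutomaton.accepts, h]
    rfl

theorem isRecognisable_iff_automatic {d : ℕ} (S : Set (Fin d → b.N)) :
    b.IsRecognisable S ↔ Automatic fun v => v ∈ S := by
  have hS : words (fun v => v ∈ S) = b.paddedRep S := by
    ext w
    exact (mem_paddedRep S w).symm
  constructor
  · rintro ⟨A, -, hA⟩
    have := A.isRegular_accepts
    rwa [show A.accepts = _ from hA, ← hS] at this
  · rintro ⟨σ, _, M, hM⟩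
    let A : b.TapeAutomaton d :=
      ⟨σ, inferInstance, M.start, fun s a => some (M.step s a), M.accept, false⟩
    have hrun : ∀ u s, A.runFrom s u = some (M.evalFrom s u) := by
      intro u
      induction u with
      | nil => intro s; rfl
      | cons a u ih =>
        intro s
        rw [DFA.evalFrom_cons, ← ih]
        rfl
    have hA : A.accepts = b.paddedRep S := by
      rw [← hS, ← hM]
      ext u
      change (∃ s ∈ M.accept, A.runFrom M.start u = some s) ↔ _
      simp only [hrun, Option.some.injEq, exists_eq_right']
      rfl
    refine ⟨A, fun u => ?_, hA⟩
    rw [hA, mem_paddedRep, mem_paddedRep, tupleVal_zero_cons]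

/-! ### Digits -/

theorem digit_valN (w : List b.Digit) (i : ℕ) : b.digit (b.valN w) i = w.reverse.getD i 0 := by
  obtain ⟨k, hk⟩ := b.exists_eq_replicate_append_rep w
  conv_rhs => rw [hk]
  rw [digit, List.reverse_append, List.reverse_replicate]
  by_cases h : i < (b.rep (b.valN w)).length
  · rw [List.getD_append _ _ _ _ (by simpa using h)]
  · rw [List.getD_append_right _ _ _ _ (by simpa using h),
      List.getD_eq_default _ _ (by simpa using h)]
    by_cases h' : i - (b.rep (b.valN w)).reverse.length < k
    · rw [List.getD_eq_getElem _ _ (by simpa using h'), List.getElem_replicate]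
    · rw [List.getD_eq_default _ _ (by simpa using h')]

theorem digit_valN_append_cons (u v : List b.Digit) (a : b.Digit) :
    b.digit (b.valN (u ++ a :: v)) v.length = a := by
  rw [digit_valN, List.reverse_append, List.reverse_cons, List.append_assoc,
    List.getD_append_right _ _ _ _ (by simp)]
  simp

theorem exists_valN_append_cons_eq (x : b.N) (i : ℕ) :
    ∃ u v, v.length = i ∧ b.valN (u ++ b.digit x i :: v) = x := by
  have key : ∃ u a v, v.length = i ∧ b.valN (u ++ a :: v) = x := by
    -- The `i + 1` extra zeros guarantee that position `i` exists in the word.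
    have h : b.valN (List.replicate (i + 1) 0 ++ b.rep x) = x :=
      Subtype.ext (by rw [coe_valN, val_replicate_zero_append, val_rep])
    set w := List.replicate (i + 1) 0 ++ b.rep x with hw
    have hl : i < w.length := by simp [hw]; omega
    refine ⟨w.take (w.length - (i + 1)), w[w.length - (i + 1)], w.drop (w.length - i), ?_, ?_⟩
    · simp; omega
    · rw [show w.length - i = w.length - (i + 1) + 1 by omega, ← List.drop_eq_getElem_cons,
        List.take_append_drop, h]
  obtain ⟨u, a, v, rfl, rfl⟩ := key
  exact ⟨u, v, rfl, by rw [digit_valN_append_cons]⟩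

/-! ### Positions and the definition of digits in the structure -/

theorem one_lt_p : 1 < b.p := b.one_lt_q.trans b.q_lt_p

theorem val_one_digit : (((1 : b.Digit) : ℕ)) = 1 := by
  rw [Fin.val_one', Nat.mod_eq_of_lt one_lt_p]

theorem one_digit_ne_zero : (1 : b.Digit) ≠ 0 := fun h => by
  have := congrArg Fin.val h
  rw [val_one_digit] at this
  exact one_ne_zero this

/-- The element whose representation is `1` followed by `i` zeros. -/
def unit (b : RationalBase) (i : ℕ) : b.N := b.valN (1 :: List.replicate i 0)

theorem coe_unit (i : ℕ) : (b.unit i : ℚ) = ((b.p : ℚ) / b.q) ^ i / b.q := by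
  rw [unit, coe_valN, val, val_one_digit, val_replicate_zero, List.length_replicate]
  push_cast
  ring

theorem length_rep_unit (i : ℕ) : (b.rep (b.unit i)).length = i + 1 := by
  rw [unit, length_rep_valN_cons _ one_digit_ne_zero, List.length_replicate]

theorem not_lengthLE_unit (i : ℕ) (x : b.N) :
    ¬ b.LengthLE (b.unit i) x ↔ (b.rep x).length ≤ i := by
  rw [LengthLE, length_rep_unit]
  omega

theorem coe_V_append_replicate_zero (u : List b.Digit) (n : ℕ) :
    (b.V (b.valN (u ++ List.replicate n 0)) : ℚ)
      = b.V (b.valN u) * ((b.p : ℚ) / b.q) ^ n := by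
  induction n with
  | zero => simp
  | succ n ih =>
    rw [List.replicate_succ', ← List.append_assoc, coe_V_append_zero, ih, pow_succ, mul_assoc]

/-- `x` is one of the elements represented by `1 0 ⋯ 0`. -/
def IsUnit (x : b.N) : Prop := ¬ x + x = x ∧ b.q • x = b.V x

/-- The value of `1 0 ⋯ 0` with `i` zeros is `(p / q) ^ i / q`, and `V` sends it to `(p / q) ^ i`.
The condition `¬ x + x = x` excludes `0` without a constant symbol. -/
theorem isUnit_iff (x : b.N) : IsUnit x ↔ ∃ i, x = b.unit i := by
  have hq := b.q_pos.ne'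
  constructor
  · rintro ⟨h0, h⟩
    have hx : x ≠ 0 := fun h => h0 (by simp [h])
    obtain ⟨i, -, hi, -⟩ := exists_V_eq hx
    refine ⟨i, Subtype.ext ?_⟩
    have := congrArg Subtype.val h
    rw [hi, AddSubmonoidClass.coe_nsmul, nsmul_eq_mul] at this
    rw [coe_unit, ← this]
    field_simp
  · rintro ⟨i, rfl⟩
    have hu := coe_unit (b := b) i
    have hr := pow_pos (ratio_pos (b := b)) i
    refine ⟨fun h => ?_, Subtype.ext ?_⟩
    · have := congrArg Subtype.val h
      rw [AddSubmonoid.coe_add, add_eq_left, hu, div_eq_zero_iff] at this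
      exact this.elim hr.ne' hq
    · rw [AddSubmonoidClass.coe_nsmul, nsmul_eq_mul, hu]
      have h1 := V_append_singleton (b := b) [] one_digit_ne_zero
      rw [List.nil_append] at h1
      rw [unit, ← List.singleton_append, coe_V_append_replicate_zero, h1]
      simp [val, hq]
      field_simp

/-- Moving one position to the left multiplies by `p / q`; clearing the denominator leaves an
equation between sums. -/
theorem unit_succ_iff (i j : ℕ) : b.q • b.unit i = b.p • b.unit j ↔ i = j + 1 := by
  have hq := b.q_pos.ne'
  rw [Subtype.ext_iff, AddSubmonoidClass.coe_nsmul, AddSubmonoidClass.coe_nsmul, nsmul_eq_mul,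
    nsmul_eq_mul,
    coe_unit, coe_unit, mul_div_cancel₀ _ hq,
    show (b.p : ℚ) * (((b.p : ℚ) / b.q) ^ j / b.q) = ((b.p : ℚ) / b.q) ^ (j + 1) by
      rw [pow_succ]; ring]
  exact pow_right_inj₀ ratio_pos one_lt_ratio.ne'

/-- If `e` is represented by `1 0 ⋯ 0`, then `x` has the digit `a` at the position of the `1`. -/
def HasDigit (a : b.Digit) (x e : b.N) : Prop :=
  ∃ z t, x = z + (a : ℕ) • e + t ∧ ¬ b.LengthLE e t ∧ (z + z = z ∨ ¬ b.LengthLE (b.V z) e)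

theorem val_append_cons (u v : List b.Digit) (a : b.Digit) :
    b.val (u ++ a :: v)
      = b.val (u ++ List.replicate (v.length + 1) 0) + (a : ℕ) * b.unit v.length + b.val v := by
  rw [coe_unit, val_append, val_append_replicate_zero, val, List.length_cons]
  ring

/-- An expansion of `x` is cut into blocks: `t` has length at most `i`, and `z` ends in at least `i
+ 1` zeros, so no carry occurs. For `z ≠ 0` with `V z = (p / q) ^ j`, the representation of `V z` is
`q` followed by `j` zeros, and being longer than `e` says `j ≥ i + 1`; `z = 0` needs its own clause
since `V 0 = 0`. -/
theorem hasDigit_iff (a : b.Digit) (x : b.N) (i : ℕ) :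
    HasDigit a x (b.unit i) ↔ b.digit x i = a := by
  constructor
  · rintro ⟨z, t, rfl, ht, hz⟩
    obtain ⟨u, hu⟩ : ∃ u, b.valN (u ++ List.replicate (i + 1) 0) = z := by
      by_cases h0 : z = 0
      · exact ⟨[], Subtype.ext (by simp [h0, val_replicate_zero])⟩
      · obtain ⟨j, w, hj, hw⟩ := exists_V_eq h0
        have hV : b.V z = b.valN (⟨b.q, b.q_lt_p⟩ :: List.replicate j 0) := by
          ext
          simp [hj, val, val_replicate_zero, b.q_pos.ne']
        have hl : (b.rep (b.V z)).length = j + 1 := by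
          rw [hV, length_rep_valN_cons, List.length_replicate]
          intro h
          have := congrArg Fin.val h
          have h1 := b.one_lt_q
          simp at this
          omega
        have : i + 1 ≤ j := by
          rcases hz with hz | hz
          · exact absurd (add_eq_left.1 (congrArg Subtype.val hz)) (fun h => h0 (Subtype.ext h))
          · rw [LengthLE, hl, length_rep_unit] at hz
            omega
        refine ⟨w ++ List.replicate (j - (i + 1)) 0, ?_⟩
        rw [List.append_assoc, ← List.replicate_add, Nat.sub_add_cancel this, hw]
    obtain ⟨v, rfl, hv⟩ : ∃ v, v.length = i ∧ b.valN v = t := by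
      rw [not_lengthLE_unit] at ht
      exact ⟨List.replicate (i - (b.rep t).length) 0 ++ b.rep t, by simp; omega,
        Subtype.ext (by rw [coe_valN, val_replicate_zero_append, val_rep])⟩
    refine Eq.trans ?_ (digit_valN_append_cons u v a)
    congr 1
    ext
    rw [coe_valN, val_append_cons, ← hu, ← hv]
    simp [-nsmul_eq_mul, nsmul_eq_mul]
  · intro h
    obtain ⟨u, v, rfl, hx⟩ := exists_valN_append_cons_eq x i
    rw [h] at hx
    refine ⟨b.valN (u ++ List.replicate (v.length + 1) 0), b.valN v, ?_, ?_, ?_⟩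
    · rw [← hx]
      ext
      rw [coe_valN, val_append_cons]
      simp
    · rw [not_lengthLE_unit]
      exact b.length_rep_valN_le v
    · by_cases h0 : b.valN u = 0
      · left
        have : b.valN (u ++ List.replicate (v.length + 1) 0) = 0 := by
          ext
          rw [coe_valN, val_append_replicate_zero, ← coe_valN, h0]
          simp
        simp [this]
      · right
        obtain ⟨j, -, hj, -⟩ := exists_V_eq h0
        have hV : b.V (b.valN (u ++ List.replicate (v.length + 1) 0))
            = b.valN (⟨b.q, b.q_lt_p⟩ :: List.replicate (j + (v.length + 1)) 0) := by
          ext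
          rw [coe_V_append_replicate_zero, hj, ← pow_add]
          simp [val, val_replicate_zero, b.q_pos.ne']
        rw [hV, LengthLE, length_rep_unit, length_rep_valN_cons, List.length_replicate]
        · omega
        · intro h
          have := congrArg Fin.val h
          have h1 := b.one_lt_q
          simp at this
          omega

/-! ### Definable predicates -/

/-- A function given by a term. -/
def IsTermFun (f : (α → b.N) → b.N) : Prop := ∃ t : logic.Term α, ∀ v, t.realize v = f v

theorem isTermFun_var (i : α) : IsTermFun fun v : α → b.N => v i :=
  ⟨.var i, fun _ => rfl⟩

theorem IsTermFun.comp {f : (α → b.N) → b.N} (hf : IsTermFun f) (g : α → β) :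
    IsTermFun fun v : β → b.N => f (v ∘ g) := by
  obtain ⟨t, ht⟩ := hf
  exact ⟨t.relabel g, fun v => by rw [FirstOrder.Language.Term.realize_relabel, ht]⟩

theorem IsTermFun.add {f g : (α → b.N) → b.N} (hf : IsTermFun f) (hg : IsTermFun g) :
    IsTermFun fun v => f v + g v := by
  obtain ⟨t, ht⟩ := hf
  obtain ⟨u, hu⟩ := hg
  obtain rfl : (fun v => t.realize v) = f := funext ht
  obtain rfl : (fun v => u.realize v) = g := funext hu
  exact ⟨.func (L := logic) LogicFunc.add ![t, u], fun v => rfl⟩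

theorem IsTermFun.V {f : (α → b.N) → b.N} (hf : IsTermFun f) :
    IsTermFun fun v => b.V (f v) := by
  obtain ⟨t, ht⟩ := hf
  obtain rfl : (fun v => t.realize v) = f := funext ht
  exact ⟨.func (L := logic) LogicFunc.V ![t], fun v => rfl⟩

/-- The multiple `0` is excluded because the language has no constant. -/
theorem IsTermFun.nsmul {f : (α → b.N) → b.N} (hf : IsTermFun f) {n : ℕ} (hn : n ≠ 0) :
    IsTermFun fun v => n • f v := by
  induction n with
  | zero => exact absurd rfl hn
  | succ n ih =>
    rcases n with _ | n
    · simpa using hf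
    · simpa only [succ_nsmul _ (n + 1)] using (ih n.succ_ne_zero).add hf

/-- A predicate that defines a definable set. -/
def DefinablePred (P : (α → b.N) → Prop) : Prop :=
  ∃ φ : logic.Formula α, ∀ v, φ.Realize v ↔ P v

theorem definablePred_eq {f g : (α → b.N) → b.N} (hf : IsTermFun f) (hg : IsTermFun g) :
    DefinablePred fun v => f v = g v := by
  obtain ⟨t, ht⟩ := hf
  obtain ⟨u, hu⟩ := hg
  exact ⟨t.equal u, fun v => by rw [FirstOrder.Language.Formula.realize_equal, ht, hu]⟩

theorem definablePred_lengthLE {f g : (α → b.N) → b.N} (hf : IsTermFun f) (hg : IsTermFun g) :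
    DefinablePred fun v => b.LengthLE (f v) (g v) := by
  obtain ⟨t, ht⟩ := hf
  obtain ⟨u, hu⟩ := hg
  obtain rfl : (fun v => t.realize v) = f := funext ht
  obtain rfl : (fun v => u.realize v) = g := funext hu
  exact ⟨FirstOrder.Language.Relations.formula (L := logic) LogicRel.lengthLE ![t, u],
    fun v => FirstOrder.Language.Formula.realize_rel.trans Iff.rfl⟩

namespace DefinablePred

theorem const (p : Prop) : DefinablePred fun _ : α → b.N => p := by
  by_cases h : p
  · exact ⟨⊤, by simp [h]⟩
  · exact ⟨⊥, by simp [h]⟩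

theorem not {P : (α → b.N) → Prop} (hP : DefinablePred P) : DefinablePred fun v => ¬ P v := by
  obtain ⟨φ, hφ⟩ := hP
  exact ⟨φ.not, fun v => by rw [FirstOrder.Language.Formula.realize_not, hφ]⟩

theorem and {P Q : (α → b.N) → Prop} (hP : DefinablePred P) (hQ : DefinablePred Q) :
    DefinablePred fun v => P v ∧ Q v := by
  obtain ⟨φ, hφ⟩ := hP
  obtain ⟨ψ, hψ⟩ := hQ
  exact ⟨φ ⊓ ψ, fun v => by rw [FirstOrder.Language.Formula.realize_inf, hφ, hψ]⟩

theorem or {P Q : (α → b.N) → Prop} (hP : DefinablePred P) (hQ : DefinablePred Q) :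
    DefinablePred fun v => P v ∨ Q v := by
  obtain ⟨φ, hφ⟩ := hP
  obtain ⟨ψ, hψ⟩ := hQ
  exact ⟨φ ⊔ ψ, fun v => by rw [FirstOrder.Language.Formula.realize_sup, hφ, hψ]⟩

theorem imp {P Q : (α → b.N) → Prop} (hP : DefinablePred P) (hQ : DefinablePred Q) :
    DefinablePred fun v => P v → Q v := by
  obtain ⟨φ, hφ⟩ := hP
  obtain ⟨ψ, hψ⟩ := hQ
  exact ⟨φ.imp ψ, fun v => by rw [FirstOrder.Language.Formula.realize_imp, hφ, hψ]⟩

theorem exists_finite [Finite γ] {P : γ → (α → b.N) → Prop} (hP : ∀ i, DefinablePred (P i)) :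
    DefinablePred fun v => ∃ i, P i v := by
  choose φ hφ using hP
  exact ⟨.iSup φ, fun v => by simp [hφ]⟩

theorem forall_finite [Finite γ] {P : γ → (α → b.N) → Prop} (hP : ∀ i, DefinablePred (P i)) :
    DefinablePred fun v => ∀ i, P i v := by
  choose φ hφ using hP
  exact ⟨.iInf φ, fun v => by simp [hφ]⟩

theorem exs [Finite β] {P : (α → b.N) → (β → b.N) → Prop}
    (hP : DefinablePred fun w : α ⊕ β → b.N => P (w ∘ Sum.inl) (w ∘ Sum.inr)) :
    DefinablePred fun v => ∃ u, P v u := by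
  obtain ⟨φ, hφ⟩ := hP
  refine ⟨φ.iExs β, fun v => ?_⟩
  rw [FirstOrder.Language.Formula.realize_iExs]
  exact exists_congr fun u => hφ _

theorem ex {P : (α → b.N) → b.N → Prop}
    (hP : DefinablePred fun w : α ⊕ Unit → b.N => P (w ∘ Sum.inl) (w (Sum.inr ()))) :
    DefinablePred fun v => ∃ x, P v x := by
  obtain ⟨φ, hφ⟩ := DefinablePred.exs (β := Unit) (P := fun v u => P v (u ())) hP
  exact ⟨φ, fun v => (hφ v).trans ⟨fun ⟨u, h⟩ => ⟨_, h⟩, fun ⟨x, h⟩ => ⟨fun _ => x, h⟩⟩⟩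

theorem all {P : (α → b.N) → b.N → Prop}
    (hP : DefinablePred fun w : α ⊕ Unit → b.N => P (w ∘ Sum.inl) (w (Sum.inr ()))) :
    DefinablePred fun v => ∀ x, P v x := by
  obtain ⟨φ, hφ⟩ := (DefinablePred.ex (P := fun v x => ¬ P v x) hP.not).not
  exact ⟨φ, fun v => (hφ v).trans not_exists_not⟩

end DefinablePred

theorem definablePred_isUnit {f : (α → b.N) → b.N} (hf : IsTermFun f) :
    DefinablePred fun v => IsUnit (f v) :=
  (definablePred_eq (hf.add hf) hf).not.and
    (definablePred_eq (hf.nsmul (zero_lt_one.trans b.one_lt_q).ne') hf.V)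

theorem definablePred_hasDigit (a : b.Digit) {x e : (α → b.N) → b.N} (hx : IsTermFun x)
    (he : IsTermFun e) : DefinablePred fun v => HasDigit a (x v) (e v) := by
  refine .ex (.ex ?_)
  have hx' := (hx.comp (Sum.inl : α → α ⊕ Unit)).comp (Sum.inl : _ → (α ⊕ Unit) ⊕ Unit)
  have he' := (he.comp (Sum.inl : α → α ⊕ Unit)).comp (Sum.inl : _ → (α ⊕ Unit) ⊕ Unit)
  have hz : IsTermFun fun v : (α ⊕ Unit) ⊕ Unit → b.N => v (.inl (.inr ())) := isTermFun_var _
  have ht : IsTermFun fun v : (α ⊕ Unit) ⊕ Unit → b.N => v (.inr ()) := isTermFun_var _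
  refine .and ?_ ((definablePred_lengthLE he' ht).not.and
    ((definablePred_eq (hz.add hz) hz).or (definablePred_lengthLE hz.V he').not))
  -- For the digit `0` the summand `a • e` is not given by a term and is dropped.
  by_cases ha : (a : ℕ) = 0
  · simpa only [ha, zero_smul, add_zero, Function.comp_apply] using
      definablePred_eq hx' (hz.add ht)
  · exact definablePred_eq hx' ((hz.add (he'.nsmul ha)).add ht)

/-! ### Recognisable sets are definable -/

theorem reverse_word_succ (x : α → b.N) (n : ℕ) :
    (word x (n + 1)).reverse = (word x n).reverse ++ [fun j => b.digit (x j) n] := by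
  simp [word, List.range_succ]

/-- `X` encodes the set of the runs of an automaton `M` on the digits of `x`, read from right to
left, that lead to a state in which `X` has the digit `1`. -/
def IsRun {σ : Type} (M : DFA (α → b.Digit) σ) (x : α → b.N) (X : σ → b.N) : Prop :=
  ∀ e, IsUnit e → ∀ s, HasDigit 1 (X s) e →
    (s = M.start ∧ ∀ e', IsUnit e' → ¬ b.q • e = b.p • e') ∨
    ∃ e', (IsUnit e' ∧ b.q • e = b.p • e') ∧ ∃ s', ∃ a : α → b.Digit,
      M.step s' a = s ∧ HasDigit 1 (X s') e' ∧ ∀ j, HasDigit (a j) (x j) e'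

/-- Soundness of the coding. `IsRun` only asks that each mark be justified by one at the previous
position; since `M` is deterministic, induction on the position shows that every mark is correct. -/
theorem IsRun.eq_eval {σ : Type} {M : DFA (α → b.Digit) σ} {x : α → b.N} {X : σ → b.N}
    (h : IsRun M x X) (i : ℕ) (s : σ) (hs : b.digit (X s) i = 1) :
    M.eval (word x i).reverse = s := by
  induction i generalizing s with
  | zero =>
    rcases h _ ((isUnit_iff _).2 ⟨0, rfl⟩) s ((hasDigit_iff _ _ _).2 hs) with
      ⟨rfl, -⟩ | ⟨e, ⟨he, h'⟩, -⟩
    · rfl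
    · obtain ⟨j, rfl⟩ := (isUnit_iff _).1 he
      have := (unit_succ_iff _ _).1 h'
      omega
  | succ i ih =>
    rcases h _ ((isUnit_iff _).2 ⟨i + 1, rfl⟩) s ((hasDigit_iff _ _ _).2 hs) with
      ⟨rfl, h'⟩ | ⟨e, ⟨he, h'⟩, s', a, rfl, hs', ha⟩
    · exact absurd ((unit_succ_iff _ _).2 rfl) (h' _ ((isUnit_iff _).2 ⟨i, rfl⟩))
    · obtain ⟨j, rfl⟩ := (isUnit_iff _).1 he
      obtain rfl : i = j := by
        have := (unit_succ_iff _ _).1 h'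
        omega
      rw [reverse_word_succ, DFA.eval_append_singleton, ih s' ((hasDigit_iff _ _ _).1 hs')]
      congr 1
      ext1 j
      rw [(hasDigit_iff _ _ _).1 (ha j)]

/-- Completeness of the coding: `X s` has the digit `1` exactly at the positions `i ≤ n` at which
the true run is in state `s`. -/
theorem exists_isRun {σ : Type} (M : DFA (α → b.Digit) σ) (x : α → b.N) (n : ℕ) :
    ∃ X, IsRun M x X ∧ b.digit (X (M.eval (word x n).reverse)) n = 1 := by
  classical
  let st : ℕ → σ := fun i => M.eval (word x i).reverse
  let X : σ → b.N := fun s =>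
    b.valN ((List.range (n + 1)).map fun i => if st i = s then (1 : b.Digit) else 0).reverse
  have hX : ∀ s i, b.digit (X s) i = 1 ↔ i ≤ n ∧ st i = s := by
    intro s i
    rw [digit_valN, List.reverse_reverse]
    by_cases hi : i < n + 1
    · rw [List.getD_eq_getElem _ _ (by simpa using hi)]
      simp [Nat.lt_succ_iff.1 hi, one_digit_ne_zero.symm]
    · rw [List.getD_eq_default _ _ (by simpa using hi)]
      simp [one_digit_ne_zero.symm]
      omega
  refine ⟨X, ?_, (hX _ _).2 ⟨le_rfl, rfl⟩⟩
  intro e he s hs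
  obtain ⟨i, rfl⟩ := (isUnit_iff _).1 he
  obtain ⟨hi, rfl⟩ := (hX _ _).1 ((hasDigit_iff _ _ _).1 hs)
  rcases i with _ | i
  · refine Or.inl ⟨rfl, fun e' he' h => ?_⟩
    obtain ⟨j, rfl⟩ := (isUnit_iff _).1 he'
    have := (unit_succ_iff _ _).1 h
    omega
  · refine Or.inr ⟨b.unit i, ⟨(isUnit_iff _).2 ⟨i, rfl⟩, (unit_succ_iff _ _).2 rfl⟩, st i,
      fun j => b.digit (x j) i, ?_, ?_, fun j => (hasDigit_iff _ _ _).2 rfl⟩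
    · simp only [st]
      rw [reverse_word_succ, DFA.eval_append_singleton]
    · exact (hasDigit_iff _ _ _).2 ((hX _ _).2 ⟨by omega, rfl⟩)

theorem definablePred_isRun {σ : Type} [Finite σ] [Finite α] (M : DFA (α → b.Digit) σ)
    {x : α → (γ → b.N) → b.N} {X : σ → (γ → b.N) → b.N} (hx : ∀ j, IsTermFun (x j))
    (hX : ∀ s, IsTermFun (X s)) :
    DefinablePred fun v => IsRun M (fun j => x j v) fun s => X s v := by
  have hu : IsTermFun fun v : γ ⊕ Unit → b.N => v (.inr ()) := isTermFun_var _
  have he : IsTermFun fun v : (γ ⊕ Unit) ⊕ Unit → b.N => v (.inl (.inr ())) := isTermFun_var _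
  have he' : IsTermFun fun v : (γ ⊕ Unit) ⊕ Unit → b.N => v (.inr ()) := isTermFun_var _
  have hq : b.q ≠ 0 := (zero_lt_one.trans b.one_lt_q).ne'
  have hp : b.p ≠ 0 := (zero_lt_one.trans one_lt_p).ne'
  have hsucc := definablePred_eq (he.nsmul hq) (he'.nsmul hp)
  refine .all ((definablePred_isUnit hu).imp (.forall_finite fun s =>
    (definablePred_hasDigit 1 ((hX s).comp Sum.inl) hu).imp (.or (.and (.const _) (.all ?_))
      (.ex (.and ?_ ?_)))))
  · exact (definablePred_isUnit he').imp hsucc.not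
  · exact (definablePred_isUnit he').and hsucc
  -- States and letters range over finite sets, so they become finite disjunctions, and the
  -- transition condition is a fixed truth value in each disjunct.
  · refine .exists_finite fun s' => .exists_finite fun a => .and (.const _) (.and ?_ ?_)
    · exact definablePred_hasDigit 1 (((hX s').comp Sum.inl).comp Sum.inl) he'
    · exact .forall_finite fun j =>
        definablePred_hasDigit (a j) (((hx j).comp Sum.inl).comp Sum.inl) he'

theorem Automatic.definablePred [Finite α] {P : (α → b.N) → Prop} (hP : Automatic P) :
    DefinablePred P := by
  -- Positions are counted from the right, so the automaton must read the lowest digit first.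
  obtain ⟨σ, _, M, hM⟩ := Language.IsRegular.reverse hP
  have hP' : ∀ x n, (∀ j, (b.rep (x j)).length ≤ n) →
      (P x ↔ M.eval (word x n).reverse ∈ M.accept) := by
    intro x n hn
    rw [← DFA.mem_accepts, hM, Language.mem_reverse, List.reverse_reverse, mem_words,
      tupleVal_word hn]
  -- The position `e` marks where the run stops. Any stop beyond all the representations gives the
  -- same verdict, as the remaining letters are leading zeros.
  have hdef : DefinablePred fun x : α → b.N => ∃ X : σ → b.N, ∃ e, IsUnit e ∧
      (∀ j, ¬ b.LengthLE e (x j)) ∧ (∃ s : M.accept, HasDigit 1 (X s) e) ∧ IsRun M x X := by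
    refine .exs (.ex ?_)
    have he : IsTermFun fun v : (α ⊕ σ) ⊕ Unit → b.N => v (.inr ()) := isTermFun_var _
    have hx : ∀ j, IsTermFun fun v : (α ⊕ σ) ⊕ Unit → b.N => v (.inl (.inl j)) :=
      fun j => isTermFun_var _
    have hX : ∀ s, IsTermFun fun v : (α ⊕ σ) ⊕ Unit → b.N => v (.inl (.inr s)) :=
      fun j => isTermFun_var _
    exact (definablePred_isUnit he).and (.and
      (.forall_finite fun j => (definablePred_lengthLE he (hx j)).not) (.and
      (.exists_finite fun s => definablePred_hasDigit 1 (hX s) he) (definablePred_isRun M hx hX)))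
  obtain ⟨φ, hφ⟩ := hdef
  refine ⟨φ, fun x => (hφ x).trans ⟨?_, fun h => ?_⟩⟩
  · rintro ⟨X, e, he, hl, ⟨⟨s, hs⟩, hd⟩, hrun⟩
    obtain ⟨n, rfl⟩ := (isUnit_iff _).1 he
    rw [hP' x n fun j => (not_lengthLE_unit _ _).1 (hl j),
      hrun.eq_eval n s ((hasDigit_iff _ _ _).1 hd)]
    exact hs
  · obtain ⟨n, hn⟩ := exists_forall_length_rep_le x
    obtain ⟨X, hrun, hd⟩ := exists_isRun M x n
    exact ⟨X, b.unit n, (isUnit_iff _).2 ⟨n, rfl⟩, fun j => (not_lengthLE_unit _ _).2 (hn j),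
      ⟨⟨_, (hP' x n hn).1 h⟩, (hasDigit_iff _ _ _).2 hd⟩, hrun⟩

theorem isDefinable_iff_automatic {d : ℕ} (S : Set (Fin d → b.N)) :
    b.IsDefinable S ↔ Automatic fun v => v ∈ S := by
  refine ⟨IsDefinable.automatic, fun h => ?_⟩
  obtain ⟨φ, hφ⟩ := h.definablePred
  refine Set.empty_definable_iff.2 ⟨φ, ?_⟩
  ext v
  exact (hφ v).symm

end RationalBase

theorem theorem1 (b : RationalBase) (d : ℕ) (hd : 0 < d) (S : Set (Fin d → b.N)) :
    b.IsRecognisable S ↔ b.IsDefinable S := by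
  rw [RationalBase.isRecognisable_iff_automatic, RationalBase.isDefinable_iff_automatic]
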